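/- Theorem. Fix a field $K$ and a finite quiver $Q$. A quiver over $Q$ is a finite quiver $Q'$ with a morphism of quivers $f'\colon Q'\to Q$; morphisms are morphisms of quivers commuting with the structure maps to $Q$. Let $\mathcal{C}$ be a full subcategory of the category of quivers over $Q$ such that: 1. $\mathcal{C}$ is acyclic: its only endomorphisms are identities and only identities are invertible; and for every object $x$ of $\mathcal C$ there are only finitely many objects $z$ of $\mathcal C$ admitting a morphism $z\to x$ (for instance, $\mathcal{C}$ has finitely many objects); 2. every object $(Q',f')$ of $\mathcal{C}$ is connected (as a quiver) and a wrapping, i.e. for all vertices $i',j'$ of $Q'$ the map $f'$ is injective on the set of arrows from $i'$ to $j'$; 3. $\mathcal{C}$ is closed under fiber products: for all $x,y\in\mathcal{C}$ the fiber product $x\times_Q y$ is isomorphic over $Q$ to a finite (possibly empty) disjoint union of objects of $\mathcal{C}$; 4. for each object $x=(Q',f')$ of $\mathcal{C}$ the linearization $L(x)=f'_*\mathbb{1}_{Q'}$ is an indecomposable representation of $Q$ over $K$, and $L(x)\not\simeq L(y)$ for distinct objects $x\neq y$ of $\mathcal{C}$. Here $\mathbb{1}_{Q'}$ has $K$ at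 each vertex and the identity over each arrow, and the pushforward $f'_*V$ has the space $\bigoplus_{f'(i)=a}V_i$ at a vertex $a$ of $Q$ and, over an arrow $\alpha$ of $Q$, the sum of the maps of $V$ over all arrows $\beta$ with $f'(\beta)=\alpha$. Let $R(Q)$ be the representation ring: the free abelian group on isomorphism classes of finite-dimensional representations of $Q$ over $K$ modulo the relations $[V\oplus W]=[V]+[W]$, with product induced by the pointwise tensor product. Let $M(\mathcal{C})$ be the Möbius ring of $\mathcal{C}$: the free abelian group on the objects of $\mathcal{C}$, with the product for which the elements $\delta_x=\sum_z\mu(z,x)\,z$ (which form a $\mathbb{Z}$-basis) are orthogonal idempotents, where $\mu$ is the Möbius function of $\mathcal C$, determined by $\mu(x,y)=0$ if there is no morphism $x\to y$, and $\sum_z|\mathrm{Hom}(x,z)|\,\mu(z,y)=1$ if $x=y$ and $=0$ if $x\ne y$. Rings and subrings are not required to contain an identity element. Then the additive extension $L\colon M(\mathcal{C})\to R(Q)$ of $x\mapsto[L(x)]$ is an injective ring homomorphism, and it is an isomorphism of $M(\mathcal{C})$ onto the subring of $R(Q)$ generated by $L(\mathcal{C})=\{[L(x)] : x\in\mathcal{C}\}$.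 -/

import Mathlib

open CategoryTheory
open scoped TensorProduct

universe u v w

/-! ### Finite quivers and quivers over a quiver -/

/-- A finite quiver: finite sets of vertices and arrows, with start and terminal vertex maps. -/
structure FinQuiver : Type (u + 1) where
  /-- vertices -/
  V : Type u
  /-- arrows -/
  E : Type u
  /-- start vertex -/
  s : E → V
  /-- terminal vertex -/
  t : E → V
  [finV : Finite V]
  [finE : Finite E]

attribute [instance] FinQuiver.finV FinQuiver.finE

/-- Morphisms of quivers. -/
@[ext]
structure FinQuiver.Hom (A B : FinQuiver.{u}) : Type u where
  /-- action on vertices -/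
  onV : A.V → B.V
  /-- action on arrows -/
  onE : A.E → B.E
  s_onE : ∀ a, B.s (onE a) = onV (A.s a)
  t_onE : ∀ a, B.t (onE a) = onV (A.t a)

/-- A quiver is connected if it is nonempty and any two vertices are joined by an unoriented
path. -/
def FinQuiver.IsConnected (A : FinQuiver.{u}) : Prop :=
  Nonempty A.V ∧
    ∀ i j : A.V, Relation.EqvGen (fun p q => ∃ a : A.E, A.s a = p ∧ A.t a = q) i j

/-- A morphism of quivers is a wrapping if for any two vertices `i`, `j` of the source it is
injective on the set of arrows from `i` to `j`. -/
def FinQuiver.Hom.IsWrapping {A B : FinQuiver.{u}} (f : FinQuiver.Hom A B) : Prop :=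
  ∀ i j : A.V, Set.InjOn f.onE {a | A.s a = i ∧ A.t a = j}

/-- A (finite) quiver over `Q`. -/
structure QuiverOver (Q : FinQuiver.{u}) : Type (u + 1) where
  /-- the underlying quiver -/
  quiver : FinQuiver.{u}
  /-- the structure map -/
  str : FinQuiver.Hom quiver Q

/-- Morphisms of quivers over `Q`: morphisms of quivers commuting with the structure maps. -/
@[ext]
structure QuiverOver.Hom {Q : FinQuiver.{u}} (X Y : QuiverOver Q) : Type u where
  /-- the underlying morphism of quivers -/
  map : FinQuiver.Hom X.quiver Y.quiver
  str_onV : ∀ i, Y.str.onV (map.onV i) = X.str.onV i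
  str_onE : ∀ a, Y.str.onE (map.onE a) = X.str.onE a

/-- The category of quivers over `Q`. -/
instance QuiverOver.instCategory (Q : FinQuiver.{u}) : Category.{u} (QuiverOver Q) where
  Hom X Y := QuiverOver.Hom X Y
  id X :=
    { map := { onV := id, onE := id, s_onE := fun _ => rfl, t_onE := fun _ => rfl }
      str_onV := fun _ => rfl
      str_onE := fun _ => rfl }
  comp f g :=
    { map :=
        { onV := g.map.onV ∘ f.map.onV
          onE := g.map.onE ∘ f.map.onE
          s_onE := fun a => by simp [g.map.s_onE, f.map.s_onE]
          t_onE := fun a => by simp [g.map.t_onE, f.map.t_onE] }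
      str_onV := fun i => by simp [g.str_onV, f.str_onV]
      str_onE := fun a => by simp [g.str_onE, f.str_onE] }

/-- There are only finitely many morphisms between two (finite) quivers over `Q`. -/
instance QuiverOver.finite_hom {Q : FinQuiver.{u}} (X Y : QuiverOver Q) : Finite (X ⟶ Y) := by
  refine Finite.of_injective
    (β := (X.quiver.V → Y.quiver.V) × (X.quiver.E → Y.quiver.E))
    (fun f => ((show QuiverOver.Hom X Y from f).map.onV,
      (show QuiverOver.Hom X Y from f).map.onE)) ?_
  intro f g h
  simp only [Prod.mk.injEq] at h
  exact QuiverOver.Hom.ext (FinQuiver.Hom.ext h.1 h.2)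

instance QuiverOver.finite_hom_full {Q : FinQuiver.{u}} (C : ObjectProperty (QuiverOver Q))
    (X Y : C.FullSubcategory) : Finite (X ⟶ Y) :=
  Finite.of_injective (fun f : X ⟶ Y => f.hom) fun _ _ h => ObjectProperty.hom_ext C h

/-- The fiber product of two quivers over `Q`. -/
def QuiverOver.fiberProduct {Q : FinQuiver.{u}} (X Y : QuiverOver Q) : QuiverOver Q where
  quiver :=
    { V := {p : X.quiver.V × Y.quiver.V // X.str.onV p.1 = Y.str.onV p.2}
      E := {a : X.quiver.E × Y.quiver.E // X.str.onE a.1 = Y.str.onE a.2}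
      s := fun a => ⟨(X.quiver.s a.1.1, Y.quiver.s a.1.2), by
        rw [← X.str.s_onE, ← Y.str.s_onE, a.2]⟩
      t := fun a => ⟨(X.quiver.t a.1.1, Y.quiver.t a.1.2), by
        rw [← X.str.t_onE, ← Y.str.t_onE, a.2]⟩ }
  str :=
    { onV := fun p => X.str.onV p.1.1
      onE := fun a => X.str.onE a.1.1
      s_onE := fun a => X.str.s_onE a.1.1
      t_onE := fun a => X.str.t_onE a.1.1 }

/-- The disjoint union of a finite family of quivers over `Q`. -/
def QuiverOver.disjointUnion {Q : FinQuiver.{u}} {n : ℕ} (w : Fin n → QuiverOver Q) :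
    QuiverOver Q where
  quiver :=
    { V := Σ i, (w i).quiver.V
      E := Σ i, (w i).quiver.E
      s := fun a => ⟨a.1, (w a.1).quiver.s a.2⟩
      t := fun a => ⟨a.1, (w a.1).quiver.t a.2⟩ }
  str :=
    { onV := fun p => (w p.1).str.onV p.2
      onE := fun a => (w a.1).str.onE a.2
      s_onE := fun a => (w a.1).str.s_onE a.2
      t_onE := fun a => (w a.1).str.t_onE a.2 }

/-- A full subcategory of the category of quivers over `Q`, given by its class `C` of objects, is
closed under fiber products if the fiber product of any two of its objects is (isomorphic over `Q`
to) a finite, possibly empty, disjoint union of objects of `C`. -/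
def ClosedUnderFiberProducts {Q : FinQuiver.{u}} (C : ObjectProperty (QuiverOver Q)) : Prop :=
  ∀ X Y : QuiverOver Q, C X → C Y →
    ∃ (n : ℕ) (w : Fin n → QuiverOver Q), (∀ i, C (w i)) ∧
      Nonempty (X.fiberProduct Y ≅ QuiverOver.disjointUnion w)

/-! ### Representations of quivers -/

/-- A finite-dimensional representation of `Q` over `K`. -/
structure QuiverRep (K : Type u) [Field K] (Q : FinQuiver.{u}) : Type (u + 1) where
  /-- the vector space at a vertex -/
  obj : Q.V → Type u
  [addCommGroup : ∀ x, AddCommGroup (obj x)]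
  [module : ∀ x, Module K (obj x)]
  [finite : ∀ x, Module.Finite K (obj x)]
  /-- the linear map over an arrow -/
  map : ∀ a : Q.E, obj (Q.s a) →ₗ[K] obj (Q.t a)

attribute [instance] QuiverRep.addCommGroup QuiverRep.module QuiverRep.finite

namespace QuiverRep

variable {K : Type u} [Field K] {Q : FinQuiver.{u}}

/-- Isomorphisms of representations. -/
structure Iso (A B : QuiverRep K Q) : Type u where
  /-- the linear isomorphism at a vertex -/
  equiv : ∀ x, A.obj x ≃ₗ[K] B.obj x
  comm : ∀ (a : Q.E) (m : A.obj (Q.s a)),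
    equiv (Q.t a) (A.map a m) = B.map a (equiv (Q.s a) m)

/-- The identity isomorphism. -/
def Iso.refl (A : QuiverRep K Q) : Iso A A where
  equiv _ := LinearEquiv.refl K _
  comm _ _ := rfl

/-- The inverse isomorphism. -/
def Iso.symm {A B : QuiverRep K Q} (e : Iso A B) : Iso B A where
  equiv x := (e.equiv x).symm
  comm a m := by
    rw [LinearEquiv.symm_apply_eq, e.comm, LinearEquiv.apply_symm_apply]

/-- Composition of isomorphisms. -/
def Iso.trans {A B D : QuiverRep K Q} (e : Iso A B) (f : Iso B D) : Iso A D where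
  equiv x := (e.equiv x).trans (f.equiv x)
  comm a m := by simp [e.comm, f.comm]

/-- Two representations are isomorphic. -/
def IsIsomorphic (A B : QuiverRep K Q) : Prop := Nonempty (Iso A B)

/-- The direct sum of two representations. -/
def directSum (A B : QuiverRep K Q) : QuiverRep K Q where
  obj x := A.obj x × B.obj x
  map a := (A.map a).prodMap (B.map a)

/-- The (pointwise) tensor product of two representations. -/
def tensor (A B : QuiverRep K Q) : QuiverRep K Q where
  obj x := A.obj x ⊗[K] B.obj x
  map a := TensorProduct.map (A.map a) (B.map a)

variable (K Q) in
/-- The identity representation: `K` at each vertex, the identity over each arrow. -/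
def identityRep : QuiverRep K Q where
  obj _ := K
  map _ := LinearMap.id

/-- A representation is zero if all its vector spaces are. -/
def IsZero (A : QuiverRep K Q) : Prop := ∀ x, Subsingleton (A.obj x)

/-- A representation is indecomposable if it is nonzero and is not isomorphic to a direct sum of
two nonzero representations. -/
def IsIndecomposable (A : QuiverRep K Q) : Prop :=
  ¬ A.IsZero ∧ ∀ B D : QuiverRep K Q, A.IsIsomorphic (B.directSum D) → B.IsZero ∨ D.IsZero

open Classical in
/-- The map over an arrow `a` of the pushforward: the sum of the maps over the (finitely many)
arrows lying over `a`, each extended by zero to the direct sum. -/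
noncomputable def pushforwardMap {P : FinQuiver.{u}} (f : FinQuiver.Hom P Q) (A : QuiverRep K P)
    (a : Q.E) :
    (∀ y : {y : P.V // f.onV y = Q.s a}, A.obj y.1) →ₗ[K]
      (∀ y : {y : P.V // f.onV y = Q.t a}, A.obj y.1) :=
  ∑ᶠ b : {b : P.E // f.onE b = a},
    LinearMap.single K (fun y : {y : P.V // f.onV y = Q.t a} => A.obj y.1)
        ⟨P.t b.1, by rw [← f.t_onE, b.2]⟩ ∘ₗ
      A.map b.1 ∘ₗ
        LinearMap.proj (φ := fun y : {y : P.V // f.onV y = Q.s a} => A.obj y.1)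
          ⟨P.s b.1, by rw [← f.s_onE, b.2]⟩

/-- The pushforward of a representation of `P` along a morphism of quivers `f : P → Q`: the space
at `x` is the (finite) direct sum of the spaces at the vertices over `x`, and the map over an arrow
`a` is the sum of the maps over the arrows lying over `a`. -/
noncomputable def pushforward {P : FinQuiver.{u}} (f : FinQuiver.Hom P Q) (A : QuiverRep K P) :
    QuiverRep K Q where
  obj x := ∀ y : {y : P.V // f.onV y = x}, A.obj y.1
  map a := pushforwardMap f A a

end QuiverRep

/-- The linearization of a quiver over `Q`: the pushforward of the identity representation along
the structure map. -/
noncomputable def QuiverOver.linearization (K : Type u) [Field K] {Q : FinQuiver.{u}}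
    (X : QuiverOver Q) : QuiverRep K Q :=
  QuiverRep.pushforward X.str (QuiverRep.identityRep K X.quiver)

/-! ### The representation ring -/

/-- Isomorphism of representations as an equivalence relation. -/
instance QuiverRep.isoSetoid (K : Type u) [Field K] (Q : FinQuiver.{u}) :
    Setoid (QuiverRep K Q) where
  r := QuiverRep.IsIsomorphic
  iseqv :=
    { refl := fun A => ⟨QuiverRep.Iso.refl A⟩
      symm := fun ⟨e⟩ => ⟨e.symm⟩
      trans := fun ⟨e⟩ ⟨f⟩ => ⟨e.trans f⟩ }

/-- Isomorphism classes of representations of `Q` over `K`. -/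
def RepClass (K : Type u) [Field K] (Q : FinQuiver.{u}) : Type (u + 1) :=
  Quotient (QuiverRep.isoSetoid K Q)

namespace RepClass

variable {K : Type u} [Field K] {Q : FinQuiver.{u}}

/-- The isomorphism class of a representation. -/
def mk (A : QuiverRep K Q) : RepClass K Q := Quotient.mk _ A

theorem mk_eq_mk_iff {A B : QuiverRep K Q} : mk A = mk B ↔ A.IsIsomorphic B :=
  Quotient.eq

/-- Isomorphism classes of representations form a commutative monoid under tensor product. -/
instance : CommMonoid (RepClass K Q) where
  mul := Quotient.map₂ QuiverRep.tensor (by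
    rintro A A' ⟨e⟩ B B' ⟨f⟩
    refine ⟨⟨fun x => TensorProduct.congr (e.equiv x) (f.equiv x), fun a m => ?_⟩⟩
    exact LinearMap.congr_fun (f := (TensorProduct.congr (e.equiv _) (f.equiv _)).toLinearMap ∘ₗ
        TensorProduct.map (A.map a) (B.map a))
      (g := TensorProduct.map (A'.map a) (B'.map a) ∘ₗ
        (TensorProduct.congr (e.equiv _) (f.equiv _)).toLinearMap)
      (TensorProduct.ext' fun _ _ => by simp [e.comm, f.comm]) m)
  one := mk (QuiverRep.identityRep K Q)
  mul_assoc := by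
    rintro ⟨A⟩ ⟨B⟩ ⟨D⟩
    refine Quotient.sound ⟨⟨fun x => TensorProduct.assoc K _ _ _, fun a m => ?_⟩⟩
    exact LinearMap.congr_fun (f := (TensorProduct.assoc K _ _ _).toLinearMap ∘ₗ
        TensorProduct.map (TensorProduct.map (A.map a) (B.map a)) (D.map a))
      (g := TensorProduct.map (A.map a) (TensorProduct.map (B.map a) (D.map a)) ∘ₗ
        (TensorProduct.assoc K _ _ _).toLinearMap)
      (TensorProduct.ext_threefold fun _ _ _ => by simp) m
  one_mul := by
    rintro ⟨A⟩
    refine Quotient.sound ⟨⟨fun x => TensorProduct.lid K _, fun a m => ?_⟩⟩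
    exact LinearMap.congr_fun (f := (TensorProduct.lid K _).toLinearMap ∘ₗ
        TensorProduct.map LinearMap.id (A.map a))
      (g := A.map a ∘ₗ (TensorProduct.lid K _).toLinearMap)
      (TensorProduct.ext' fun _ _ => by simp) m
  mul_one := by
    rintro ⟨A⟩
    refine Quotient.sound ⟨⟨fun x => TensorProduct.rid K _, fun a m => ?_⟩⟩
    exact LinearMap.congr_fun (f := (TensorProduct.rid K _).toLinearMap ∘ₗ
        TensorProduct.map (A.map a) LinearMap.id)
      (g := A.map a ∘ₗ (TensorProduct.rid K _).toLinearMap)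
      (TensorProduct.ext' fun _ _ => by simp) m
  mul_comm := by
    rintro ⟨A⟩ ⟨B⟩
    refine Quotient.sound ⟨⟨fun x => TensorProduct.comm K _ _, fun a m => ?_⟩⟩
    exact LinearMap.congr_fun (f := (TensorProduct.comm K _ _).toLinearMap ∘ₗ
        TensorProduct.map (A.map a) (B.map a))
      (g := TensorProduct.map (B.map a) (A.map a) ∘ₗ (TensorProduct.comm K _ _).toLinearMap)
      (TensorProduct.ext' fun _ _ => by simp) m

theorem mk_mul_mk (A B : QuiverRep K Q) : mk A * mk B = mk (A.tensor B) := rfl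

theorem one_eq : (1 : RepClass K Q) = mk (QuiverRep.identityRep K Q) := rfl

variable (K Q) in
/-- The elements `[A ⊕ B] - [A] - [B]` of the free abelian group on isomorphism classes. -/
def relations : Set (FreeAbelianGroup (RepClass K Q)) :=
  {r | ∃ A B : QuiverRep K Q, r = FreeAbelianGroup.of (mk (A.directSum B)) -
    FreeAbelianGroup.of (mk A) - FreeAbelianGroup.of (mk B)}

end RepClass

/-- The representation ring `R(Q)`: the free abelian group on isomorphism classes of
representations, with product induced by the tensor product, modulo the relations
`[A ⊕ B] - [A] - [B]`. The ideal and the subgroup generated by the relations are equal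
(`RepClass.span_relations`). -/
abbrev RepRing (K : Type u) [Field K] (Q : FinQuiver.{u}) : Type (u + 1) :=
  FreeAbelianGroup (RepClass K Q) ⧸ Ideal.span (RepClass.relations K Q)

/-- The class of a representation in the representation ring. -/
def QuiverRep.toRepRing {K : Type u} [Field K] {Q : FinQuiver.{u}} (A : QuiverRep K Q) :
    RepRing K Q :=
  Ideal.Quotient.mk _ (FreeAbelianGroup.of (RepClass.mk A))

theorem RepClass.mul_mk_directSum {K : Type u} [Field K] {Q : FinQuiver.{u}}
    (A B D : QuiverRep K Q) :
    mk A * mk (B.directSum D) = mk ((A.tensor B).directSum (A.tensor D)) := by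
  refine Quotient.sound ⟨⟨fun x => TensorProduct.prodRight K K _ _ _, fun a m => ?_⟩⟩
  exact LinearMap.congr_fun (f := (TensorProduct.prodRight K K _ _ _).toLinearMap ∘ₗ
      TensorProduct.map (A.map a) ((B.map a).prodMap (D.map a)))
    (g := (TensorProduct.map (A.map a) (B.map a)).prodMap (TensorProduct.map (A.map a) (D.map a)) ∘ₗ
      (TensorProduct.prodRight K K _ _ _).toLinearMap)
    (TensorProduct.ext' fun _ _ => by simp) m

theorem RepClass.span_relations (K : Type u) [Field K] (Q : FinQuiver.{u}) :
    (Ideal.span (relations K Q)).toAddSubgroup = AddSubgroup.closure (relations K Q) := by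
  apply le_antisymm
  · intro r hr
    replace hr : r ∈ Ideal.span (relations K Q) := hr
    induction hr using Submodule.span_induction with
    | mem r h => exact AddSubgroup.subset_closure h
    | zero => exact zero_mem _
    | add r r' _ _ h h' => exact add_mem h h'
    | smul c r hr h =>
      rw [smul_eq_mul]
      clear hr
      induction c using FreeAbelianGroup.induction_on with
      | zero => rw [zero_mul]; exact zero_mem _
      | of c =>
        induction h using AddSubgroup.closure_induction with
        | mem r h =>
          obtain ⟨B, D, rfl⟩ := h
          obtain ⟨A, rfl⟩ : ∃ A, mk A = c := Quotient.exists_rep c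
          refine AddSubgroup.subset_closure ⟨A.tensor B, A.tensor D, ?_⟩
          rw [mul_sub, mul_sub, FreeAbelianGroup.of_mul_of, FreeAbelianGroup.of_mul_of,
            FreeAbelianGroup.of_mul_of]
          rw [mul_mk_directSum, mk_mul_mk, mk_mul_mk]
        | zero => rw [mul_zero]; exact zero_mem _
        | add r r' _ _ h h' => rw [mul_add]; exact add_mem h h'
        | neg r _ h => rw [mul_neg]; exact neg_mem h
      | neg c h => rw [neg_mul]; exact neg_mem h
      | add c c' h h' => rw [add_mul]; exact add_mem h h'
  · rw [AddSubgroup.closure_le]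
    exact Ideal.subset_span

/-! ### Acyclic categories and the Möbius ring -/

/-- A category is acyclic if its only endomorphisms are identities and only identities are
invertible. -/
class IsAcyclicCategory (C : Type v) [Category.{w} C] : Prop where
  endo_eq_id : ∀ (x : C) (f : x ⟶ x), f = 𝟙 x
  isIso_eq_id : ∀ (x y : C) (f : x ⟶ y), IsIso f → ∃ h : x = y, f = eqToHom h

/-- Each object `x` receives morphisms from finitely many objects only. -/
class IsLowerFinite (C : Type v) [Category.{w} C] : Prop where
  finite_below : ∀ x : C, {z : C | Nonempty (z ⟶ x)}.Finite

/-- Finitely many objects suffice. -/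
instance (C : Type v) [Category.{w} C] [Finite C] : IsLowerFinite C where
  finite_below _ := Set.toFinite _

section Moebius

variable {C : Type v} [Category.{w} C]

theorem IsAcyclicCategory.antisymm [IsAcyclicCategory C] {x y : C} (f : x ⟶ y) (g : y ⟶ x) :
    x = y :=
  (isIso_eq_id x y f ⟨g, endo_eq_id _ _, endo_eq_id _ _⟩).1

/-- The number `[x, y]` of morphisms from `x` to `y`. -/
noncomputable def homCount (x y : C) : ℕ := Nat.card (x ⟶ y)

theorem homCount_self [IsAcyclicCategory C] (x : C) : homCount x x = 1 := by
  have : Unique (x ⟶ x) := ⟨⟨𝟙 x⟩, IsAcyclicCategory.endo_eq_id x⟩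
  exact Nat.card_unique

theorem nonempty_of_homCount_ne_zero {x y : C} (h : homCount x y ≠ 0) : Nonempty (x ⟶ y) := by
  by_contra h'
  rw [not_nonempty_iff] at h'
  exact h Nat.card_of_isEmpty

variable [IsLowerFinite C]

/-- The objects mapping to `x`. -/
noncomputable def below (x : C) : Finset C := (IsLowerFinite.finite_below x).toFinset

theorem mem_below {z x : C} : z ∈ below x ↔ Nonempty (z ⟶ x) := by simp [below]

open Classical in
/-- The objects `z` with `x < z ≤ y`, where `x ≤ y` means that there is a morphism from `x`
to `y`. -/
noncomputable def between (x y : C) : Finset C :=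
  (below y).filter fun z => Nonempty (x ⟶ z) ∧ z ≠ x

theorem mem_between {x y z : C} :
    z ∈ between x y ↔ Nonempty (z ⟶ y) ∧ Nonempty (x ⟶ z) ∧ z ≠ x := by
  simp [between, mem_below]

theorem card_between_lt [IsAcyclicCategory C] {x y z : C} (h : z ∈ between x y) :
    (between z y).card < (between x y).card := by
  apply Finset.card_lt_card
  obtain ⟨⟨p⟩, ⟨q⟩, hne⟩ := mem_between.1 h
  rw [Finset.ssubset_iff_of_subset]
  · exact ⟨z, h, fun h' => (mem_between.1 h').2.2 rfl⟩
  · intro a ha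
    obtain ⟨ha₁, ⟨r⟩, ha₃⟩ := mem_between.1 ha
    refine mem_between.2 ⟨ha₁, ⟨q ≫ r⟩, ?_⟩
    rintro rfl
    exact hne (IsAcyclicCategory.antisymm r q)

open Classical in
/-- The Möbius function: `μ(x, x) = 1` and
`μ(x, y) = - ∑_{x < z ≤ y} [x, z] μ(z, y)` for `x ≠ y`. -/
noncomputable def moebius [IsAcyclicCategory C] (x y : C) : ℤ :=
  if x = y then 1 else - ∑ z : between x y, (homCount x z.1 : ℤ) * moebius z.1 y
termination_by (between x y).card
decreasing_by exact card_between_lt z.2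

variable [IsAcyclicCategory C]

theorem moebius_self (x : C) : moebius x x = 1 := by
  rw [moebius, if_pos rfl]

theorem moebius_of_ne {x y : C} (h : x ≠ y) :
    moebius x y = - ∑ z ∈ between x y, (homCount x z : ℤ) * moebius z y := by
  rw [moebius, if_neg h,
    Finset.sum_coe_sort (between x y) fun z => (homCount x z : ℤ) * moebius z y]

open Classical in
/-- The defining property of the Möbius function (the terms with `z` not below `y` vanish). -/
theorem sum_homCount_mul_moebius (x y : C) :
    ∑ z ∈ below y, (homCount x z : ℤ) * moebius z y = if x = y then 1 else 0 := by
  have hfil : (below y).filter (fun z => Nonempty (x ⟶ z)) ⊆ below y := Finset.filter_subset _ _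
  rw [← Finset.sum_subset hfil]
  swap
  · intro z hz hz'
    have h0 : homCount x z = 0 := by
      by_contra h
      exact hz' (Finset.mem_filter.2 ⟨hz, nonempty_of_homCount_ne_zero h⟩)
    simp [h0]
  by_cases hxy : Nonempty (x ⟶ y)
  · have hset : (below y).filter (fun z => Nonempty (x ⟶ z)) = insert x (between x y) := by
      ext z
      simp only [Finset.mem_filter, mem_below, Finset.mem_insert, mem_between]
      constructor
      · rintro ⟨h₁, h₂⟩
        by_cases h : z = x
        · exact Or.inl h
        · exact Or.inr ⟨h₁, h₂, h⟩
      · rintro (rfl | ⟨h₁, h₂, _⟩)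
        · exact ⟨hxy, ⟨𝟙 _⟩⟩
        · exact ⟨h₁, h₂⟩
    rw [hset, Finset.sum_insert fun h => (mem_between.1 h).2.2 rfl, homCount_self]
    split_ifs with h
    · subst h
      have : between x x = ∅ := by
        ext z
        simp only [mem_between, Finset.notMem_empty, iff_false]
        rintro ⟨⟨p⟩, ⟨q⟩, hne⟩
        exact hne (IsAcyclicCategory.antisymm p q)
      simp [this, moebius_self]
    · rw [moebius_of_ne h]
      simp
  · have hset : (below y).filter (fun z => Nonempty (x ⟶ z)) = ∅ := by
      ext z
      simp only [Finset.mem_filter, mem_below, Finset.notMem_empty, iff_false]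
      rintro ⟨⟨p⟩, ⟨q⟩⟩
      exact hxy ⟨q ≫ p⟩
    rw [hset, Finset.sum_empty, if_neg]
    rintro rfl
    exact hxy ⟨𝟙 _⟩

end Moebius

/-- The additive group of the Möbius ring: the free abelian group on the objects of `C`. -/
def MobiusRing (C : Type v) : Type v := C →₀ ℤ

namespace MobiusRing

variable {C : Type v}

noncomputable instance : AddCommGroup (MobiusRing C) := inferInstanceAs (AddCommGroup (C →₀ ℤ))

/-- The basis element given by an object. -/
noncomputable def of (x : C) : MobiusRing C := Finsupp.single x (1 : ℤ)

/-- The additive map out of the Möbius ring with prescribed values on the objects. -/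
noncomputable def lift {A : Type*} [AddCommGroup A] (f : C → A) : MobiusRing C →+ A :=
  Finsupp.liftAddHom fun x => (smulAddHom ℤ A).flip (f x)

theorem lift_of {A : Type*} [AddCommGroup A] (f : C → A) (x : C) : lift f (of x) = f x :=
  (Finsupp.liftAddHom_apply_single _ _ _).trans (by simp)

theorem hom_ext {A : Type*} [AddCommGroup A] {f g : MobiusRing C →+ A}
    (h : ∀ x, f (of x) = g (of x)) : f = g :=
  Finsupp.addHom_ext' (N := A) fun x => AddMonoidHom.ext_int (h x)

variable [Category.{w} C] [IsLowerFinite C]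

/-- The additive map sending `x` to `∑_z [z, x] e_z`, where `e_z` are the standard idempotents of
the ring of finitely supported functions `C → ℤ` (with pointwise product). -/
noncomputable def zeta : MobiusRing C →+ (C →₀ ℤ) :=
  lift fun x => ∑ z ∈ below x, Finsupp.single z (homCount z x : ℤ)

theorem zeta_of_apply (x z : C) : zeta (of x) z = homCount z x := by
  classical
  rw [zeta, lift_of, Finsupp.finsetSum_apply]
  simp only [Finsupp.single_apply, Finset.sum_ite_eq']
  split_ifs with h
  · rfl
  · by_contra h'
    refine h (mem_below.2 (nonempty_of_homCount_ne_zero (C := C) fun h0 => h' ?_))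
    simp [h0]

variable [IsAcyclicCategory C]

/-- The element `δ_x = ∑_z μ(z, x) z`. -/
noncomputable def delta (x : C) : MobiusRing C := ∑ z ∈ below x, moebius z x • of z

theorem zeta_delta (x : C) : zeta (delta x) = Finsupp.single x 1 := by
  classical
  ext w
  rw [delta, map_sum, Finsupp.finsetSum_apply, Finsupp.single_apply]
  simp_rw [map_zsmul, Finsupp.smul_apply, zeta_of_apply, smul_eq_mul, mul_comm (moebius _ x)]
  rw [sum_homCount_mul_moebius]
  simp only [eq_comm]

/-- The additive map sending `e_x` to `δ_x`. -/
noncomputable def ofDelta : (C →₀ ℤ) →+ MobiusRing C :=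
  Finsupp.liftAddHom fun x => (smulAddHom ℤ (MobiusRing C)).flip (delta x)

theorem ofDelta_single (x : C) : ofDelta (Finsupp.single x 1) = delta x := by
  simp [ofDelta]

theorem zeta_ofDelta (a : C →₀ ℤ) : zeta (ofDelta a) = a := by
  have : zeta.comp (ofDelta (C := C)) = AddMonoidHom.id _ :=
    Finsupp.addHom_ext' fun x => AddMonoidHom.ext_int (by
      simp [ofDelta_single, zeta_delta])
  exact DFunLike.congr_fun this a

theorem of_mem_range_ofDelta (x : C) : of x ∈ (ofDelta (C := C)).range := by
  classical
  induction hn : (below x).card using Nat.strong_induction_on generalizing x with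
  | _ n ih =>
    have hx : x ∈ below x := mem_below.2 ⟨𝟙 x⟩
    have h : of x = delta x - ∑ z ∈ (below x).erase x, moebius z x • of z := by
      rw [delta, ← Finset.add_sum_erase _ _ hx, moebius_self, one_smul, add_sub_cancel_right]
    rw [h]
    refine sub_mem ⟨_, ofDelta_single x⟩ (sum_mem fun z hz => zsmul_mem (ih _ ?_ z rfl) _)
    obtain ⟨hzx, hz⟩ := Finset.mem_erase.1 hz
    obtain ⟨p⟩ := mem_below.1 hz
    rw [← hn]
    apply Finset.card_lt_card
    rw [Finset.ssubset_iff_of_subset]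
    · refine ⟨x, hx, fun h => ?_⟩
      obtain ⟨q⟩ := mem_below.1 h
      exact hzx (IsAcyclicCategory.antisymm p q)
    · intro y hy
      obtain ⟨q⟩ := mem_below.1 hy
      exact mem_below.2 ⟨q ≫ p⟩

theorem ofDelta_zeta (a : MobiusRing C) : ofDelta (zeta a) = a := by
  have : (ofDelta (C := C)).comp zeta = AddMonoidHom.id _ := hom_ext fun x => by
    obtain ⟨b, hb⟩ := of_mem_range_ofDelta x
    simp [← hb, zeta_ofDelta]
  exact DFunLike.congr_fun this a

/-- The product of the Möbius ring: the `δ_x`, which form a `ℤ`-basis, are declared to be orthogonal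
idempotents (`MobiusRing.delta_mul_delta`), and this is extended bilinearly. -/
noncomputable instance : Mul (MobiusRing C) := ⟨fun a b => ofDelta (zeta a * zeta b)⟩

theorem mul_def (a b : MobiusRing C) : a * b = ofDelta (zeta a * zeta b) := rfl

theorem zeta_mul (a b : MobiusRing C) : zeta (a * b) = zeta a * zeta b := by
  rw [mul_def, zeta_ofDelta]

theorem zeta_injective : Function.Injective (zeta (C := C)) :=
  Function.LeftInverse.injective ofDelta_zeta

/-- The Möbius ring, a commutative ring that need not have an identity element. -/
noncomputable instance : NonUnitalCommRing (MobiusRing C) where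
  __ := (inferInstance : AddCommGroup (MobiusRing C))
  mul := (· * ·)
  left_distrib a b c := zeta_injective (by simp only [zeta_mul, map_add, mul_add])
  right_distrib a b c := zeta_injective (by simp only [zeta_mul, map_add, add_mul])
  zero_mul a := zeta_injective (by simp only [zeta_mul, map_zero, zero_mul])
  mul_zero a := zeta_injective (by simp only [zeta_mul, map_zero, mul_zero])
  mul_assoc a b c := zeta_injective (by simp only [zeta_mul, mul_assoc])
  mul_comm a b := zeta_injective (by simp only [zeta_mul, mul_comm])

open Classical in
theorem delta_mul_delta (x y : C) : delta x * delta y = if x = y then delta x else 0 := by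
  apply zeta_injective
  ext z
  rw [zeta_mul, zeta_delta, zeta_delta, Finsupp.mul_apply]
  split_ifs with h
  · subst h
    rw [zeta_delta, Finsupp.single_apply]
    split_ifs <;> simp
  · rw [map_zero, Finsupp.single_apply, Finsupp.single_apply]
    split_ifs with h₁ h₂
    · exact absurd (h₁.trans h₂.symm) h
    all_goals simp

/-- The basis elements are recovered from the idempotents. -/
theorem of_eq_sum_delta (x : C) : of x = ∑ z ∈ below x, homCount z x • delta z := by
  have h : ∀ z : C, ofDelta (Finsupp.single z (homCount z x : ℤ)) = homCount z x • delta z := by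
    intro z
    rw [← ofDelta_single, ← map_nsmul, Finsupp.smul_single, nsmul_eq_mul, mul_one]
  rw [← ofDelta_zeta (of x), zeta, lift_of, map_sum]
  exact Finset.sum_congr rfl fun z _ => h z

/-- The product of two basis elements. -/
theorem of_mul_of (x y : C) :
    of x * of y = ∑ w ∈ below x, (homCount w x * homCount w y) • delta w := by
  apply zeta_injective
  ext z
  classical
  rw [zeta_mul, Finsupp.mul_apply, zeta_of_apply, zeta_of_apply, map_sum, Finsupp.finsetSum_apply]
  simp_rw [map_nsmul, zeta_delta, Finsupp.smul_apply, Finsupp.single_apply, smul_ite, smul_zero,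
    Finset.sum_ite_eq', nsmul_eq_mul, mul_one]
  split_ifs with h
  · push_cast; rfl
  · have h0 : homCount z x = 0 := by
      by_contra h'
      exact h (mem_below.2 (nonempty_of_homCount_ne_zero h'))
    simp [h0]

end MobiusRing

/-- The additive extension `M(C) → R(Q)` of the linearization, for a full subcategory of the
category of quivers over `Q` with class of objects `C`. -/
noncomputable def linearizationMap (K : Type u) [Field K] {Q : FinQuiver.{u}}
    (C : ObjectProperty (QuiverOver Q)) : MobiusRing C.FullSubcategory →+ RepRing K Q :=
  MobiusRing.lift fun X => (X.obj.linearization K).toRepRing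

/-!
Sending an object `X` of `C` to the function `Z ↦ |Hom(Z, X)|` identifies the product of the Möbius
ring with the pointwise product of functions. A morphism from a connected quiver to a disjoint union
factors uniquely through one of the components, so if `X ×_Q Y` is the disjoint union of
`w₁, …, wₙ`, then `|Hom(Z, X)| * |Hom(Z, Y)| = ∑ i, |Hom(Z, wᵢ)|` for all `Z` in `C`, that is,
`X * Y = ∑ i, wᵢ`. In the representation ring, the same relation holds because the space of `L(X)`
at a vertex is the space of functions on the fiber of `X`, so that fiber products become tensor
products and disjoint unions become direct sums. Hence `L` is multiplicative.

For injectivity, the endomorphism ring of an indecomposable representation `A` is local by Fitting's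
lemma, so the non-split homomorphisms `A ⟶ V` form a subspace `rad(A, V)` of `Hom(A, V)`. The
dimension of `Hom(A, V) / rad(A, V)` is additive in `V`, vanishes on the indecomposables that are
not isomorphic to `A`, and is positive on `A`.
-/

section SummandRank

open Limits

variable (K : Type u) [Field K] {C : Type v} [Category.{w} C] [Preadditive C]

theorem isIso_of_isSplitMono {A B : C} [Nontrivial (End A)] [IsLocalRing (End B)] (f : A ⟶ B)
    [IsSplitMono f] : IsIso f := by
  let e : End B := retraction f ≫ f
  have he : e * e = e := by simp [e, End.mul_def]
  have he_ne_zero : e ≠ 0 := fun h => one_ne_zero (α := End A) <| calc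
    𝟙 A = f ≫ e ≫ retraction f := by simp [e]
    _ = 0 := by rw [h]; exact (congrArg (f ≫ ·) zero_comp).trans comp_zero
  rcases IsLocalRing.isUnit_or_isUnit_of_add_one (add_sub_cancel e 1) with h | h
  · exact ⟨retraction f, IsSplitMono.id f, (h.mul_eq_left).1 he⟩
  · refine absurd ((h.mul_right_eq_zero).1 ?_) he_ne_zero
    rw [sub_mul, one_mul, he, sub_self]

variable [Linear K C]

/-- The homomorphisms `f : A ⟶ V` that do not embed `A` as a direct summand of `V`: no composite
`A ⟶ V ⟶ A` is invertible. They form a subspace because `End A` is local. -/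
def radicalHoms (A V : C) [IsLocalRing (End A)] : Submodule K (A ⟶ V) where
  carrier := {f | ∀ g : V ⟶ A, (f ≫ g : End A) ∈ nonunits (End A)}
  zero_mem' g := by
    rw [zero_comp]
    exact zero_mem_nonunits.2 zero_ne_one
  add_mem' hf hf' g := by
    rw [Preadditive.add_comp]
    exact IsLocalRing.nonunits_add (hf g) (hf' g)
  smul_mem' c f hf g := by
    rw [Linear.smul_comp, ← Linear.comp_smul]
    exact hf (c • g)

variable {K}

theorem comp_mem_radicalHoms {A V W : C} [IsLocalRing (End A)] {f : A ⟶ V}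
    (hf : f ∈ radicalHoms K A V) (g : V ⟶ W) : f ≫ g ∈ radicalHoms K A W := fun h => by
  rw [Category.assoc]
  exact hf (g ≫ h)

theorem id_notMem_radicalHoms (A : C) [IsLocalRing (End A)] : 𝟙 A ∉ radicalHoms K A A :=
  fun h => h (𝟙 A) ((Category.comp_id (𝟙 A)).symm ▸ isUnit_one (M := End A))

theorem radicalHoms_eq_top {A B : C} [IsLocalRing (End A)] [IsLocalRing (End B)]
    (h : IsEmpty (A ≅ B)) : radicalHoms K A B = ⊤ := by
  refine eq_top_iff.2 fun f _ g hfg => h.elim ?_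
  have : IsIso (f ≫ g) := (isUnit_iff_isIso _).1 hfg
  have : IsSplitMono f := ⟨⟨g ≫ inv (f ≫ g), by rw [← Category.assoc, IsIso.hom_inv_id]⟩⟩
  have := isIso_of_isSplitMono f
  exact asIso f

variable (K) in
/-- The dimension of `Hom(A, V) / rad(A, V)`. If `V` is a direct sum of objects with local
endomorphism rings, this is the number of summands isomorphic to `A`, multiplied by the dimension
of the division algebra `End A / rad(A, A)`. -/
noncomputable def summandRank (A V : C) [IsLocalRing (End A)] : ℕ :=
  Module.finrank K ((A ⟶ V) ⧸ radicalHoms K A V)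

theorem summandRank_congr (A : C) [IsLocalRing (End A)] {V W : C} (e : V ≅ W) :
    summandRank K A V = summandRank K A W := by
  refine (Submodule.Quotient.equiv _ _ (Linear.homCongr K (Iso.refl A) e) ?_).finrank_eq
  apply le_antisymm
  · rintro _ ⟨f, hf, rfl⟩
    simpa [Linear.homCongr_apply] using comp_mem_radicalHoms hf e.hom
  · exact fun f hf => ⟨f ≫ e.inv, comp_mem_radicalHoms hf e.inv, by simp [Linear.homCongr_apply]⟩

theorem summandRank_eq_zero {A B : C} [IsLocalRing (End A)] [IsLocalRing (End B)]
    (h : IsEmpty (A ≅ B)) : summandRank K A B = 0 := by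
  rw [summandRank, radicalHoms_eq_top h]
  exact Module.finrank_zero_of_subsingleton

variable [∀ V W : C, FiniteDimensional K (V ⟶ W)]

theorem summandRank_self_pos (A : C) [IsLocalRing (End A)] : 0 < summandRank K A A := by
  have : Nontrivial ((A ⟶ A) ⧸ radicalHoms K A A) := Submodule.Quotient.nontrivial_iff.2
    fun h => id_notMem_radicalHoms (K := K) A (h ▸ Submodule.mem_top)
  exact Module.finrank_pos

theorem summandRank_biproduct (A : C) [IsLocalRing (End A)] {V W : C} {b : BinaryBicone V W}
    (hb : b.IsBilimit) : summandRank K A b.pt = summandRank K A V + summandRank K A W := by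
  let φ : (A ⟶ b.pt) →ₗ[K] ((A ⟶ V) ⧸ radicalHoms K A V) × ((A ⟶ W) ⧸ radicalHoms K A W) :=
    ((radicalHoms K A V).mkQ ∘ₗ Linear.rightComp K A b.fst).prod
      ((radicalHoms K A W).mkQ ∘ₗ Linear.rightComp K A b.snd)
  have mem_ker (f : A ⟶ b.pt) : f ∈ LinearMap.ker φ ↔
      f ≫ b.fst ∈ radicalHoms K A V ∧ f ≫ b.snd ∈ radicalHoms K A W := by
    simp [φ]
  have hker : LinearMap.ker φ = radicalHoms K A b.pt := by
    ext f
    rw [mem_ker]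
    refine ⟨fun ⟨hV, hW⟩ => ?_,
      fun hf => ⟨comp_mem_radicalHoms hf b.fst, comp_mem_radicalHoms hf b.snd⟩⟩
    rw [← Category.comp_id f, ← IsBilimit.binary_total hb, Preadditive.comp_add,
      ← Category.assoc, ← Category.assoc]
    exact add_mem (comp_mem_radicalHoms hV b.inl) (comp_mem_radicalHoms hW b.inr)
  have hsurj : Function.Surjective φ := by
    rintro ⟨f, g⟩
    obtain ⟨f, rfl⟩ := Submodule.mkQ_surjective _ f
    obtain ⟨g, rfl⟩ := Submodule.mkQ_surjective _ g
    exact ⟨f ≫ b.inl + g ≫ b.inr, by simp [φ]⟩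
  rw [summandRank, ← hker, (φ.quotKerEquivOfSurjective hsurj).finrank_eq, Module.finrank_prod,
    summandRank, summandRank]

end SummandRank

namespace QuiverRep

variable {K : Type u} [Field K] {Q : FinQuiver.{u}}

section Category

/-- The space of homomorphisms of representations, as a subspace of the families of linear maps. -/
def homs (A B : QuiverRep K Q) : Submodule K (∀ x, A.obj x →ₗ[K] B.obj x) where
  carrier := {f | ∀ a, f (Q.t a) ∘ₗ A.map a = B.map a ∘ₗ f (Q.s a)}
  zero_mem' a := by simp
  add_mem' hf hg a := by
    simp only [Pi.add_apply, LinearMap.add_comp, LinearMap.comp_add, hf a, hg a]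
  smul_mem' c f hf a := by
    simp only [Pi.smul_apply, LinearMap.smul_comp, LinearMap.comp_smul, hf a]

instance : Category.{u} (QuiverRep K Q) where
  Hom A B := homs A B
  id A := ⟨fun _ => LinearMap.id, fun _ => rfl⟩
  comp f g := ⟨fun x => g.1 x ∘ₗ f.1 x, fun a => by
    rw [LinearMap.comp_assoc, f.2 a, ← LinearMap.comp_assoc, g.2 a, LinearMap.comp_assoc]⟩

noncomputable instance (A B : QuiverRep K Q) : AddCommGroup (A ⟶ B) :=
  inferInstanceAs (AddCommGroup (homs A B))

noncomputable instance (A B : QuiverRep K Q) : Module K (A ⟶ B) :=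
  inferInstanceAs (Module K (homs A B))

instance (A B : QuiverRep K Q) : FiniteDimensional K (A ⟶ B) :=
  inferInstanceAs (FiniteDimensional K (homs A B))

/-- The component of a homomorphism of representations at a vertex. -/
noncomputable def app {A B : QuiverRep K Q} (x : Q.V) : (A ⟶ B) →ₗ[K] (A.obj x →ₗ[K] B.obj x) :=
  LinearMap.proj x ∘ₗ (homs A B).subtype

variable {A B D : QuiverRep K Q}

@[ext]
theorem hom_ext {f g : A ⟶ B} (h : ∀ x, app x f = app x g) : f = g :=
  Subtype.ext (funext h)

@[simp]
theorem app_comp (f : A ⟶ B) (g : B ⟶ D) (x : Q.V) : app x (f ≫ g) = app x g ∘ₗ app x f := rfl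

theorem app_map (f : A ⟶ B) (a : Q.E) (m : A.obj (Q.s a)) :
    app (Q.t a) f (A.map a m) = B.map a (app (Q.s a) f m) :=
  LinearMap.congr_fun (f.2 a) m

noncomputable instance : Preadditive (QuiverRep K Q) where
  add_comp _ _ _ _ _ _ := by ext; simp
  comp_add _ _ _ _ _ _ := by ext; simp

noncomputable instance : Linear K (QuiverRep K Q) where
  smul_comp _ _ _ _ _ _ := by ext; simp
  comp_smul _ _ _ _ _ _ := by ext; simp

theorem app_pow (f : End A) (n : ℕ) (x : Q.V) :
    app x (f ^ n) = (app x f : Module.End K (A.obj x)) ^ n := by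
  induction n with
  | zero => rfl
  | succ n ih => rw [pow_succ, pow_succ, ← ih]; rfl

/-- An isomorphism of representations, as an isomorphism in the category of representations. -/
def Iso.toCategoryIso (e : Iso A B) : A ≅ B where
  hom := ⟨fun x => e.equiv x, fun a => LinearMap.ext (e.comm a)⟩
  inv := ⟨fun x => (e.equiv x).symm, fun a => LinearMap.ext (e.symm.comm a)⟩
  hom_inv_id := hom_ext fun x => LinearMap.ext (e.equiv x).symm_apply_apply
  inv_hom_id := hom_ext fun x => LinearMap.ext (e.equiv x).apply_symm_apply

/-- The isomorphism of representations given by a homomorphism that is bijective at each vertex. -/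
noncomputable def Iso.ofBijective (f : A ⟶ B) (hf : ∀ x, Function.Bijective (app x f)) :
    Iso A B where
  equiv x := LinearEquiv.ofBijective (app x f) (hf x)
  comm := app_map f

theorem isIso_iff_bijective_app {f : A ⟶ B} :
    IsIso f ↔ ∀ x, Function.Bijective (app x f) := by
  refine ⟨fun _ x => Function.bijective_iff_has_inverse.2 ⟨app x (inv f), fun m => ?_, fun m => ?_⟩,
    fun h => (Iso.ofBijective f h).toCategoryIso.isIso_hom⟩
  · exact LinearMap.congr_fun (congrArg (app x) (IsIso.hom_inv_id f)) m
  · exact LinearMap.congr_fun (congrArg (app x) (IsIso.inv_hom_id f)) m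

theorem isIsomorphic_iff_nonempty_iso : A.IsIsomorphic B ↔ Nonempty (A ≅ B) :=
  ⟨fun ⟨e⟩ => ⟨e.toCategoryIso⟩,
    fun ⟨e⟩ => ⟨.ofBijective e.hom (isIso_iff_bijective_app.1 e.isIso_hom)⟩⟩

variable (A B) in
/-- The direct sum of representations, with its injections and projections. -/
noncomputable def biproduct : Limits.BinaryBicone A B where
  pt := A.directSum B
  fst := ⟨fun _ => LinearMap.fst K _ _, fun _ => rfl⟩
  snd := ⟨fun _ => LinearMap.snd K _ _, fun _ => rfl⟩
  inl := ⟨fun _ => LinearMap.inl K _ _, fun a => LinearMap.ext fun _ =>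
    Prod.ext rfl (map_zero (B.map a)).symm⟩
  inr := ⟨fun _ => LinearMap.inr K _ _, fun a => LinearMap.ext fun _ =>
    Prod.ext (map_zero (A.map a)).symm rfl⟩

variable (A B) in
/-- The direct sum is a biproduct in the category of representations. -/
noncomputable def isBilimitBiproduct : (biproduct A B).IsBilimit :=
  Limits.isBinaryBilimitOfTotal _ <| hom_ext fun x => by
    rw [map_add]
    exact LinearMap.coprod_inl_inr

end Category

section Indecomposable

variable {A B : QuiverRep K Q}

/-- A family of subspaces of the spaces of a representation that is mapped into itself by the maps
of the representation, that is, a subrepresentation. -/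
def IsInvariant (A : QuiverRep K Q) (p : ∀ x, Submodule K (A.obj x)) : Prop :=
  ∀ a, ∀ m ∈ p (Q.s a), A.map a m ∈ p (Q.t a)

/-- An invariant family of subspaces as a representation. -/
def sub {p : ∀ x, Submodule K (A.obj x)} (hp : A.IsInvariant p) : QuiverRep K Q where
  obj x := p x
  map a := (A.map a).restrict (hp a)

theorem isIsomorphic_directSum_sub {p q : ∀ x, Submodule K (A.obj x)} (hp : A.IsInvariant p)
    (hq : A.IsInvariant q) (h : ∀ x, IsCompl (p x) (q x)) :
    A.IsIsomorphic ((sub hp).directSum (sub hq)) := by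
  refine ⟨Iso.symm ⟨fun x => Submodule.prodEquivOfIsCompl (p x) (q x) (h x), ?_⟩⟩
  rintro a ⟨⟨m, _⟩, ⟨n, _⟩⟩
  exact (map_add (A.map a) m n).symm

theorem IsIndecomposable.eq_bot_or_eq_bot (hA : A.IsIndecomposable)
    {p q : ∀ x, Submodule K (A.obj x)} (hp : A.IsInvariant p) (hq : A.IsInvariant q)
    (h : ∀ x, IsCompl (p x) (q x)) : (∀ x, p x = ⊥) ∨ (∀ x, q x = ⊥) :=
  (hA.2 _ _ (isIsomorphic_directSum_sub hp hq h)).imp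
    (fun h x => (Submodule.subsingleton_iff_eq_bot (p := p x)).1 (h x))
    (fun h x => (Submodule.subsingleton_iff_eq_bot (p := q x)).1 (h x))

theorem isInvariant_ker (f : A ⟶ B) : A.IsInvariant fun x => LinearMap.ker (app x f) :=
  fun a m hm => by
    rw [LinearMap.mem_ker] at hm ⊢
    rw [app_map, hm, map_zero]

theorem isInvariant_range (f : A ⟶ B) : B.IsInvariant fun x => LinearMap.range (app x f) := by
  rintro a _ ⟨m, rfl⟩
  exact ⟨A.map a m, app_map f a m⟩

/-- Fitting's lemma. -/
theorem IsIndecomposable.isNilpotent_or_isUnit (hA : A.IsIndecomposable) (f : End A) :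
    IsNilpotent f ∨ IsUnit f := by
  obtain ⟨n, hn⟩ := (Filter.eventually_all.2 fun x =>
    LinearMap.eventually_isCompl_ker_pow_range_pow (app x f)).exists_forall_of_atTop
  replace hn : ∀ x, IsCompl (LinearMap.ker (app x (f ^ (n + 1))))
      (LinearMap.range (app x (f ^ (n + 1)))) := fun x => by
    rw [app_pow]
    exact hn (n + 1) n.le_succ x
  rcases hA.eq_bot_or_eq_bot (isInvariant_ker _) (isInvariant_range _) hn with hker | hrange
  · refine .inr ((isUnit_pow_iff n.succ_ne_zero).1 ((isUnit_iff_isIso _).2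
      (isIso_iff_bijective_app.2 fun x => ⟨LinearMap.ker_eq_bot.1 (hker x), ?_⟩)))
    exact LinearMap.range_eq_top.1 (eq_top_of_bot_isCompl (hker x ▸ hn x))
  · exact .inl ⟨n + 1, hom_ext fun x => LinearMap.range_eq_bot.1 (hrange x)⟩

theorem IsIndecomposable.isLocalRing_end (hA : A.IsIndecomposable) : IsLocalRing (End A) := by
  have : Nontrivial (End A) := by
    refine ⟨𝟙 A, 0, fun h => hA.1 fun x => subsingleton_of_forall_eq 0 fun m => ?_⟩
    exact LinearMap.congr_fun (congrArg (app x) h) m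
  exact .of_isUnit_or_isUnit_one_sub_self fun f =>
    (hA.isNilpotent_or_isUnit f).symm.imp_right IsNilpotent.isUnit_one_sub

end Indecomposable

end QuiverRep

section RepresentationRing

variable {K : Type u} [Field K] {Q : FinQuiver.{u}}

/-- The function on isomorphism classes induced by an isomorphism invariant of representations. -/
def RepClass.lift {G : Type*} (f : QuiverRep K Q → G)
    (hiso : ∀ A B : QuiverRep K Q, A.IsIsomorphic B → f A = f B) : RepClass K Q → G :=
  Quotient.lift f hiso

theorem RepClass.lift_mk {G : Type*} {f : QuiverRep K Q → G}
    (hiso : ∀ A B : QuiverRep K Q, A.IsIsomorphic B → f A = f B) (A : QuiverRep K Q) :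
    lift f hiso (mk A) = f A :=
  rfl

namespace RepRing

/-- The additive map out of the representation ring induced by an isomorphism invariant of
representations that is additive on direct sums. -/
noncomputable def lift {G : Type*} [AddCommGroup G] (f : QuiverRep K Q → G)
    (hiso : ∀ A B : QuiverRep K Q, A.IsIsomorphic B → f A = f B)
    (hadd : ∀ A B : QuiverRep K Q, f (A.directSum B) = f A + f B) : RepRing K Q →+ G :=
  QuotientAddGroup.lift (Ideal.span (RepClass.relations K Q)).toAddSubgroup
    (FreeAbelianGroup.lift (RepClass.lift f hiso)) <| by
      rw [RepClass.span_relations, AddSubgroup.closure_le]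
      rintro _ ⟨A, B, rfl⟩
      simp only [SetLike.mem_coe, AddMonoidHom.mem_ker, map_sub, FreeAbelianGroup.lift_apply_of,
        RepClass.lift_mk, hadd, add_sub_cancel_left, sub_self]

theorem lift_toRepRing {G : Type*} [AddCommGroup G] {f : QuiverRep K Q → G}
    (hiso : ∀ A B : QuiverRep K Q, A.IsIsomorphic B → f A = f B)
    (hadd : ∀ A B : QuiverRep K Q, f (A.directSum B) = f A + f B) (A : QuiverRep K Q) :
    lift f hiso hadd A.toRepRing = f A :=
  FreeAbelianGroup.lift_apply_of _ _

end RepRing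

namespace QuiverRep

theorem IsIsomorphic.toRepRing_eq {A B : QuiverRep K Q} (h : A.IsIsomorphic B) :
    A.toRepRing = B.toRepRing := by
  rw [toRepRing, toRepRing, RepClass.mk_eq_mk_iff.2 h]

theorem toRepRing_directSum (A B : QuiverRep K Q) :
    (A.directSum B).toRepRing = A.toRepRing + B.toRepRing := by
  rw [← sub_eq_zero, ← sub_sub, toRepRing, toRepRing, toRepRing, ← map_sub, ← map_sub,
    Ideal.Quotient.eq_zero_iff_mem]
  exact Ideal.subset_span ⟨A, B, rfl⟩

theorem toRepRing_tensor (A B : QuiverRep K Q) :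
    (A.tensor B).toRepRing = A.toRepRing * B.toRepRing := by
  rw [toRepRing, toRepRing, toRepRing, ← map_mul, FreeAbelianGroup.of_mul_of, RepClass.mk_mul_mk]

theorem IsZero.toRepRing_eq_zero {A : QuiverRep K Q} (hA : A.IsZero) : A.toRepRing = 0 := by
  have isIsomorphic_directSum_self : A.IsIsomorphic (A.directSum A) := by
    refine ⟨.ofBijective (biproduct A A).inl fun x => ?_⟩
    have : Subsingleton (A.obj x) := hA x
    exact ⟨Function.injective_of_subsingleton _, fun p => ⟨0, Subsingleton.elim (α := _ × _) _ _⟩⟩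
  simpa [toRepRing_directSum] using isIsomorphic_directSum_self.toRepRing_eq

/-- The rank `summandRank` as an additive function on the representation ring. -/
noncomputable def summandRankHom (A : QuiverRep K Q) [IsLocalRing (End A)] : RepRing K Q →+ ℤ :=
  RepRing.lift (fun V => (summandRank K A V : ℤ))
    (fun _ _ h => congrArg _ (summandRank_congr A (isIsomorphic_iff_nonempty_iso.1 h).some))
    (fun V W => by exact_mod_cast summandRank_biproduct A (isBilimitBiproduct V W))

theorem linearIndependent_toRepRing {ι : Type*} (A : ι → QuiverRep K Q)
    (hind : ∀ i, (A i).IsIndecomposable)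
    (hniso : ∀ i j, (A i).IsIsomorphic (A j) → i = j) :
    LinearIndependent ℤ fun i => (A i).toRepRing := by
  have (i : ι) : IsLocalRing (End (A i)) := (hind i).isLocalRing_end
  have summandRankHom_toRepRing (i : ι) (V : QuiverRep K Q) :
      summandRankHom (A i) V.toRepRing = summandRank K (A i) V := RepRing.lift_toRepRing _ _ V
  refine linearIndependent_iff'.2 fun s c hc i hi => ?_
  have summandRank_eq_zero_of_ne (j : ι) (hji : j ≠ i) : summandRank K (A i) (A j) = 0 :=
    summandRank_eq_zero (not_nonempty_iff.1 fun h =>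
      hji (hniso i j (isIsomorphic_iff_nonempty_iso.2 h)).symm)
  have c_mul_eq_zero : c i * summandRank K (A i) (A i) = 0 := calc
    _ = ∑ j ∈ s, c j * (summandRank K (A i) (A j) : ℤ) := .symm <|
      Finset.sum_eq_single_of_mem i hi fun j _ hji => by simp [summandRank_eq_zero_of_ne j hji]
    _ = summandRankHom (A i) (∑ j ∈ s, c j • (A j).toRepRing) := by
      simp only [map_sum, map_zsmul, summandRankHom_toRepRing, smul_eq_mul]
    _ = 0 := by rw [hc, map_zero]
  exact (mul_eq_zero.1 c_mul_eq_zero).resolve_right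
    (Int.natCast_ne_zero.2 (summandRank_self_pos (A i)).ne')

end QuiverRep

end RepresentationRing

namespace QuiverOver

variable {K : Type u} [Field K] {Q : FinQuiver.{u}} {X Y Z : QuiverOver Q}

/-- The vertices over a vertex of `Q`. -/
abbrev Fiber (X : QuiverOver Q) (x : Q.V) : Type u := {i : X.quiver.V // X.str.onV i = x}

/-- The arrows over an arrow of `Q` that end at a given vertex. -/
abbrev ArrowsTo (X : QuiverOver Q) (a : Q.E) (j : X.quiver.V) : Type u :=
  {b : X.quiver.E // X.str.onE b = a ∧ X.quiver.t b = j}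

/-- The start vertex of an arrow over `a`, as a vertex over the start vertex of `a`. -/
def ArrowsTo.start {a : Q.E} {j : X.quiver.V} (b : X.ArrowsTo a j) : X.Fiber (Q.s a) :=
  ⟨X.quiver.s b.1, by rw [← X.str.s_onE, b.2.1]⟩

variable (K) in
/-- The space of the linearization at a vertex, as the space of functions on the fiber. -/
noncomputable def linearizationEquiv (X : QuiverOver Q) (x : Q.V) :
    (X.linearization K).obj x ≃ₗ[K] (X.Fiber x → K) := LinearEquiv.refl K (X.Fiber x → K)

theorem linearization_ext {x : Q.V} {p q : (X.linearization K).obj x}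
    (h : ∀ j, linearizationEquiv K X x p j = linearizationEquiv K X x q j) : p = q :=
  (linearizationEquiv K X x).injective (funext h)

theorem pushforwardMap_identityRep_apply (a : Q.E)
    (p : ∀ i : X.Fiber (Q.s a), (QuiverRep.identityRep K X.quiver).obj i.1)
    (j : X.Fiber (Q.t a)) :
    (QuiverRep.pushforwardMap X.str (QuiverRep.identityRep K X.quiver) a p j : K) =
      ∑ᶠ b : X.ArrowsTo a j.1, (p b.start : K) := by
  classical
  have := Fintype.ofFinite {b : X.quiver.E // X.str.onE b = a}
  have := Fintype.ofFinite (X.ArrowsTo a j.1)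
  rw [QuiverRep.pushforwardMap, finsum_eq_sum_of_fintype, LinearMap.sum_apply, Finset.sum_apply]
  refine Eq.trans (Eq.symm ?_) (finsum_eq_sum_of_fintype _).symm
  refine Fintype.sum_of_injective (fun b : X.ArrowsTo a j.1 => Subtype.mk b.1 b.2.1)
    (fun b c h => Subtype.ext (Subtype.mk.inj h)) _ _ (fun b hb => ?_) ?_
  · refine Pi.single_eq_of_ne (fun h => hb ⟨⟨b.1, b.2, ?_⟩, rfl⟩) _
    rw [h]
  · rintro ⟨b, hb, hj⟩
    obtain ⟨j, _⟩ := j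
    dsimp only at hj
    subst hj
    exact (Pi.single_eq_same (M := fun _ : X.Fiber (Q.t a) => K) _ _).symm

theorem linearizationEquiv_map_apply (a : Q.E) (p : (X.linearization K).obj (Q.s a))
    (j : X.Fiber (Q.t a)) :
    linearizationEquiv K X _ ((X.linearization K).map a p) j =
      ∑ᶠ b : X.ArrowsTo a j.1, linearizationEquiv K X _ p b.start :=
  pushforwardMap_identityRep_apply a p j

theorem isZero_linearization [IsEmpty X.quiver.V] : (X.linearization K).IsZero := fun _ =>
  ⟨fun _ _ => linearization_ext fun j => isEmptyElim j.1⟩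

section Fibration

/-- A morphism over `Q` is a fibration if for each vertex `j` of the source every arrow ending in
the image of `j` lifts to a unique arrow ending in `j`. Functions can be pulled back along such
morphisms compatibly with linearization. -/
def Hom.IsFibration (f : QuiverOver.Hom X Y) : Prop :=
  ∀ j, Set.BijOn f.map.onE {b | X.quiver.t b = j} {c | Y.quiver.t c = f.map.onV j}

/-- The map induced by a morphism on the fibers over a vertex of `Q`. -/
def Hom.onFiber (f : QuiverOver.Hom X Y) (x : Q.V) (i : X.Fiber x) : Y.Fiber x :=
  ⟨f.map.onV i.1, (f.str_onV _).trans i.2⟩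

variable {f : QuiverOver.Hom X Y} {g : QuiverOver.Hom Z Y}

/-- Lifting of arrows along a fibration. -/
noncomputable def Hom.IsFibration.arrowsToEquiv (hf : f.IsFibration) (a : Q.E) (j : X.quiver.V) :
    X.ArrowsTo a j ≃ Y.ArrowsTo a (f.map.onV j) :=
  .ofBijective (fun b => ⟨f.map.onE b.1, (f.str_onE _).trans b.2.1, (hf j).mapsTo b.2.2⟩)
    ⟨fun b c h => Subtype.ext ((hf j).injOn b.2.2 c.2.2 (congrArg Subtype.val h)), fun c => by
      obtain ⟨b, hb, hbc⟩ := (hf j).surjOn c.2.2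
      exact ⟨⟨b, by rw [← f.str_onE, hbc, c.2.1], hb⟩, Subtype.ext hbc⟩⟩

variable (K) in
/-- The pullback of functions along a morphism over `Q`. -/
noncomputable def Hom.pullback (f : QuiverOver.Hom X Y) (x : Q.V) :
    (Y.linearization K).obj x →ₗ[K] (X.linearization K).obj x :=
  (linearizationEquiv K X x).symm ∘ₗ LinearMap.funLeft K K (f.onFiber x) ∘ₗ
    linearizationEquiv K Y x

theorem Hom.IsFibration.pullback_map (hf : f.IsFibration) (a : Q.E)
    (p : (Y.linearization K).obj (Q.s a)) :
    f.pullback K _ ((Y.linearization K).map a p) =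
      (X.linearization K).map a (f.pullback K _ p) := linearization_ext fun j => by
  have start_arrowsToEquiv (b : X.ArrowsTo a j.1) :
      (hf.arrowsToEquiv a j.1 b).start = f.onFiber _ b.start := Subtype.ext (f.map.s_onE b.1)
  calc
    _ = ∑ᶠ c : Y.ArrowsTo a (f.map.onV j.1), linearizationEquiv K Y _ p c.start :=
      linearizationEquiv_map_apply a p (f.onFiber _ j)
    _ = ∑ᶠ b : X.ArrowsTo a j.1, linearizationEquiv K Y _ p (f.onFiber _ b.start) := by
      simp only [← finsum_comp_equiv (hf.arrowsToEquiv a j.1), start_arrowsToEquiv]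
    _ = _ := (linearizationEquiv_map_apply a (f.pullback K _ p) j).symm

theorem Hom.IsFibration.isIsomorphic_linearization (hf : f.IsFibration)
    (hV : Function.Bijective f.map.onV) :
    (Y.linearization K).IsIsomorphic (X.linearization K) := by
  have hfx (x : Q.V) : Function.Bijective (f.onFiber x) :=
    ⟨fun i j h => Subtype.ext (hV.1 (congrArg Subtype.val h)), fun j => by
      obtain ⟨i, hi⟩ := hV.2 j.1
      exact ⟨⟨i, by rw [← f.str_onV, hi, j.2]⟩, Subtype.ext hi⟩⟩
  exact ⟨fun x => linearizationEquiv K Y x ≪≫ₗ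
      LinearEquiv.funCongrLeft K K (.ofBijective _ (hfx x)) ≪≫ₗ (linearizationEquiv K X x).symm,
    hf.pullback_map⟩

theorem Hom.IsFibration.isIsomorphic_linearization_directSum (hf : f.IsFibration)
    (hg : g.IsFibration) (hV : Function.Bijective (Sum.elim f.map.onV g.map.onV)) :
    (Y.linearization K).IsIsomorphic ((X.linearization K).directSum (Z.linearization K)) := by
  have hfg (x : Q.V) : Function.Bijective (Sum.elim (f.onFiber x) (g.onFiber x)) := by
    refine ⟨?_, fun j => ?_⟩
    · rintro (i | i) (i' | i') h
      · exact congrArg _ (Subtype.ext (Sum.inl_injective (@hV.1 (.inl _) (.inl _)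
          (congrArg Subtype.val h))))
      · cases @hV.1 (.inl _) (.inr _) (congrArg Subtype.val h)
      · cases @hV.1 (.inr _) (.inl _) (congrArg Subtype.val h)
      · exact congrArg _ (Subtype.ext (Sum.inr_injective (@hV.1 (.inr _) (.inr _)
          (congrArg Subtype.val h))))
    · obtain ⟨i | i, hi⟩ := hV.2 j.1
      · exact ⟨.inl ⟨i, by rw [← f.str_onV, ← j.2]; exact congrArg _ hi⟩, Subtype.ext hi⟩
      · exact ⟨.inr ⟨i, by rw [← g.str_onV, ← j.2]; exact congrArg _ hi⟩, Subtype.ext hi⟩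
  exact ⟨fun x => linearizationEquiv K Y x ≪≫ₗ
      LinearEquiv.funCongrLeft K K (.ofBijective _ (hfg x)) ≪≫ₗ
      LinearEquiv.sumArrowLequivProdArrow _ _ K K,
    fun a p => Prod.ext (hf.pullback_map a p) (hg.pullback_map a p)⟩

theorem leftInverse_onV (e : X ≅ Y) :
    Function.LeftInverse (e.inv : QuiverOver.Hom Y X).map.onV
      (e.hom : QuiverOver.Hom X Y).map.onV :=
  congrFun (congrArg (fun f : QuiverOver.Hom X X => f.map.onV) e.hom_inv_id)

theorem leftInverse_onE (e : X ≅ Y) :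
    Function.LeftInverse (e.inv : QuiverOver.Hom Y X).map.onE
      (e.hom : QuiverOver.Hom X Y).map.onE :=
  congrFun (congrArg (fun f : QuiverOver.Hom X X => f.map.onE) e.hom_inv_id)

theorem isFibration_hom (e : X ≅ Y) : Hom.IsFibration (e.hom : QuiverOver.Hom X Y) := fun j =>
  ⟨fun b hb => (Hom.map _).t_onE b |>.trans (congrArg _ hb), (leftInverse_onE e).injective.injOn,
    fun c hc => ⟨_, ((e.inv : QuiverOver.Hom Y X).map.t_onE c).trans
      ((congrArg _ hc).trans (leftInverse_onV e j)), leftInverse_onE e.symm c⟩⟩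

theorem isIsomorphic_linearization_of_iso (e : X ≅ Y) :
    (Y.linearization K).IsIsomorphic (X.linearization K) :=
  (isFibration_hom e).isIsomorphic_linearization
    ⟨(leftInverse_onV e).injective, (leftInverse_onV e.symm).surjective⟩

end Fibration

section DisjointUnion

variable {m n : ℕ}

/-- The inclusion of a component of a disjoint union. -/
def inclusion (w : Fin n → QuiverOver Q) (i : Fin n) :
    QuiverOver.Hom (w i) (disjointUnion w) where
  map :=
    { onV := fun j => ⟨i, j⟩
      onE := fun a => ⟨i, a⟩
      s_onE := fun _ => rfl
      t_onE := fun _ => rfl }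
  str_onV _ := rfl
  str_onE _ := rfl

/-- The inclusion of the disjoint union of some of the components of a disjoint union. -/
def reindex (w : Fin n → QuiverOver Q) (σ : Fin m → Fin n) :
    QuiverOver.Hom (disjointUnion (w ∘ σ)) (disjointUnion w) where
  map :=
    { onV := fun j => ⟨σ j.1, j.2⟩
      onE := fun a => ⟨σ a.1, a.2⟩
      s_onE := fun _ => rfl
      t_onE := fun _ => rfl }
  str_onV _ := rfl
  str_onE _ := rfl

theorem injective_onV_inclusion (w : Fin n → QuiverOver Q) (i : Fin n) :
    Function.Injective (inclusion w i).map.onV :=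
  sigma_mk_injective (β := fun i => (w i).quiver.V)

theorem injective_onE_inclusion (w : Fin n → QuiverOver Q) (i : Fin n) :
    Function.Injective (inclusion w i).map.onE :=
  sigma_mk_injective (β := fun i => (w i).quiver.E)

theorem isFibration_inclusion (w : Fin n → QuiverOver Q) (i : Fin n) :
    (inclusion w i).IsFibration := by
  refine fun j => ⟨?_, (injective_onE_inclusion w i).injOn, ?_⟩
  · rintro b rfl
    rfl
  · rintro ⟨i', c⟩ hc
    obtain rfl : i' = i := congrArg Sigma.fst hc
    exact ⟨c, injective_onV_inclusion w i' hc, rfl⟩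

theorem injective_onV_reindex (w : Fin n → QuiverOver Q) {σ : Fin m → Fin n}
    (hσ : Function.Injective σ) : Function.Injective (reindex w σ).map.onV := by
  rintro ⟨i, b⟩ ⟨j, c⟩ h
  obtain rfl : i = j := hσ (congrArg Sigma.fst h)
  obtain rfl : b = c := injective_onV_inclusion w (σ i) h
  rfl

theorem injective_onE_reindex (w : Fin n → QuiverOver Q) {σ : Fin m → Fin n}
    (hσ : Function.Injective σ) : Function.Injective (reindex w σ).map.onE := by
  rintro ⟨i, b⟩ ⟨j, c⟩ h
  obtain rfl : i = j := hσ (congrArg Sigma.fst h)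
  obtain rfl : b = c := injective_onE_inclusion w (σ i) h
  rfl

theorem isFibration_reindex (w : Fin n → QuiverOver Q) {σ : Fin m → Fin n}
    (hσ : Function.Injective σ) : (reindex w σ).IsFibration := by
  refine fun j => ⟨?_, (injective_onE_reindex w hσ).injOn, ?_⟩
  · rintro b rfl
    rfl
  · rintro ⟨i, c⟩ hc
    obtain rfl : i = σ j.1 := congrArg Sigma.fst hc
    exact ⟨⟨j.1, c⟩, injective_onV_reindex w hσ hc, rfl⟩

theorem isIsomorphic_linearization_disjointUnion_succ (w : Fin (n + 1) → QuiverOver Q) :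
    ((disjointUnion w).linearization K).IsIsomorphic (((w 0).linearization K).directSum
      ((disjointUnion (w ∘ Fin.succ)).linearization K)) := by
  refine (isFibration_inclusion w 0).isIsomorphic_linearization_directSum
    (isFibration_reindex w (Fin.succ_injective n)) ⟨?_, ?_⟩
  · exact (injective_onV_inclusion w 0).sumElim
      (injective_onV_reindex w (Fin.succ_injective n)) fun _ j h =>
        Fin.succ_ne_zero j.1 (congrArg Sigma.fst h).symm
  · rintro ⟨i, j⟩
    induction i using Fin.cases with
    | zero => exact ⟨.inl j, rfl⟩
    | succ i => exact ⟨.inr ⟨i, j⟩, rfl⟩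

theorem toRepRing_linearization_disjointUnion (w : Fin n → QuiverOver Q) :
    ((disjointUnion w).linearization K).toRepRing = ∑ i, ((w i).linearization K).toRepRing := by
  induction n with
  | zero =>
    have : IsEmpty (disjointUnion w).quiver.V := inferInstanceAs (IsEmpty (Σ i, (w i).quiver.V))
    rw [isZero_linearization.toRepRing_eq_zero, Fin.sum_univ_zero]
  | succ n ih =>
    rw [(isIsomorphic_linearization_disjointUnion_succ w).toRepRing_eq,
      QuiverRep.toRepRing_directSum, ih, Fin.sum_univ_succ]
    rfl

end DisjointUnion

section FiberProduct

/-- The fibers of a fiber product are the products of the fibers. -/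
def fiberProductFiberEquiv (X Y : QuiverOver Q) (x : Q.V) :
    (X.fiberProduct Y).Fiber x ≃ X.Fiber x × Y.Fiber x where
  toFun i := (⟨i.1.1.1, i.2⟩, ⟨i.1.1.2, i.1.2.symm.trans i.2⟩)
  invFun i := ⟨⟨(i.1.1, i.2.1), i.1.2.trans i.2.2.symm⟩, i.1.2⟩
  left_inv _ := rfl
  right_inv _ := rfl

/-- An arrow of a fiber product ending at a given vertex is a pair of such arrows of the factors. -/
def fiberProductArrowsToEquiv (a : Q.E) (j : (X.fiberProduct Y).quiver.V) :
    (X.fiberProduct Y).ArrowsTo a j ≃ X.ArrowsTo a j.1.1 × Y.ArrowsTo a j.1.2 where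
  toFun b := (⟨b.1.1.1, b.2.1, congrArg (fun i => i.1.1) b.2.2⟩,
    ⟨b.1.1.2, b.1.2.symm.trans b.2.1, congrArg (fun i => i.1.2) b.2.2⟩)
  invFun b := ⟨⟨(b.1.1, b.2.1), b.1.2.1.trans b.2.2.1.symm⟩, b.1.2.1,
    Subtype.ext (Prod.ext b.1.2.2 b.2.2.2)⟩
  left_inv _ := rfl
  right_inv _ := rfl

variable (K X Y) in
/-- The space of functions on a fiber of the fiber product, as the tensor product of the spaces of
functions on the fibers of the factors. -/
noncomputable def tensorLinearizationEquiv (x : Q.V) :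
    (X.linearization K).obj x ⊗[K] (Y.linearization K).obj x ≃ₗ[K]
      ((X.fiberProduct Y).linearization K).obj x :=
  (((Module.Basis.ofEquivFun (linearizationEquiv K X x)).tensorProduct
    (Module.Basis.ofEquivFun (linearizationEquiv K Y x))).equivFun.trans
      (LinearEquiv.funCongrLeft K K (fiberProductFiberEquiv X Y x))).trans
        (linearizationEquiv K (X.fiberProduct Y) x).symm

theorem tensorLinearizationEquiv_tmul_apply (x : Q.V) (p : (X.linearization K).obj x)
    (q : (Y.linearization K).obj x) (i : (X.fiberProduct Y).Fiber x) :
    linearizationEquiv K _ x (tensorLinearizationEquiv K X Y x (p ⊗ₜ q)) i =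
      linearizationEquiv K X x p (fiberProductFiberEquiv X Y x i).1 *
        linearizationEquiv K Y x q (fiberProductFiberEquiv X Y x i).2 := by
  refine (Module.Basis.tensorProduct_repr_tmul_apply _ _ p q _ _).trans ?_
  rw [smul_eq_mul, mul_comm, Module.Basis.ofEquivFun_repr_apply,
    Module.Basis.ofEquivFun_repr_apply]
  rfl

theorem tensorLinearizationEquiv_map_tmul (a : Q.E) (p : (X.linearization K).obj (Q.s a))
    (q : (Y.linearization K).obj (Q.s a)) :
    tensorLinearizationEquiv K X Y _ ((X.linearization K).map a p ⊗ₜ (Y.linearization K).map a q) =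
      ((X.fiberProduct Y).linearization K).map a (tensorLinearizationEquiv K X Y _ (p ⊗ₜ q)) :=
  linearization_ext fun j => calc
    _ = (∑ᶠ b : X.ArrowsTo a j.1.1.1, linearizationEquiv K X _ p b.start) *
          ∑ᶠ c : Y.ArrowsTo a j.1.1.2, linearizationEquiv K Y _ q c.start := by
      rw [tensorLinearizationEquiv_tmul_apply, linearizationEquiv_map_apply,
        linearizationEquiv_map_apply]
      rfl
    _ = ∑ᶠ d : X.ArrowsTo a j.1.1.1 × Y.ArrowsTo a j.1.1.2,
          linearizationEquiv K X _ p d.1.start * linearizationEquiv K Y _ q d.2.start := by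
      have := Fintype.ofFinite (X.ArrowsTo a j.1.1.1)
      have := Fintype.ofFinite (Y.ArrowsTo a j.1.1.2)
      simp only [finsum_eq_sum_of_fintype, Fintype.sum_prod_type, Finset.sum_mul_sum]
    _ = ∑ᶠ d : (X.fiberProduct Y).ArrowsTo a j.1, linearizationEquiv K (X.fiberProduct Y) _
          (tensorLinearizationEquiv K X Y _ (p ⊗ₜ q)) d.start := by
      rw [← finsum_comp_equiv (fiberProductArrowsToEquiv a j.1)]
      exact finsum_congr fun d => (tensorLinearizationEquiv_tmul_apply _ p q d.start).symm
    _ = _ := (linearizationEquiv_map_apply a _ j).symm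

theorem isIsomorphic_tensor_linearization (X Y : QuiverOver Q) :
    ((X.linearization K).tensor (Y.linearization K)).IsIsomorphic
      ((X.fiberProduct Y).linearization K) := by
  refine ⟨⟨tensorLinearizationEquiv K X Y, fun a => LinearMap.congr_fun
    (f := (tensorLinearizationEquiv K X Y (Q.t a)).toLinearMap ∘ₗ
      TensorProduct.map ((X.linearization K).map a) ((Y.linearization K).map a))
    (g := ((X.fiberProduct Y).linearization K).map a ∘ₗ
      (tensorLinearizationEquiv K X Y (Q.s a)).toLinearMap) ?_⟩⟩
  exact TensorProduct.ext' (tensorLinearizationEquiv_map_tmul a)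

theorem toRepRing_linearization_fiberProduct (X Y : QuiverOver Q) :
    ((X.fiberProduct Y).linearization K).toRepRing =
      (X.linearization K).toRepRing * (Y.linearization K).toRepRing := by
  rw [← QuiverRep.toRepRing_tensor, (isIsomorphic_tensor_linearization X Y).toRepRing_eq]

end FiberProduct

section Counting

variable {n : ℕ} {w : Fin n → QuiverOver Q} {X Y Z : QuiverOver Q}

/-- The universal property of the fiber product. -/
def homFiberProductEquiv (Z X Y : QuiverOver Q) :
    (Z ⟶ X.fiberProduct Y) ≃ (Z ⟶ X) × (Z ⟶ Y) where
  toFun (f : QuiverOver.Hom Z (X.fiberProduct Y)) :=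
    ({ map :=
        { onV := fun i => (f.map.onV i).1.1
          onE := fun a => (f.map.onE a).1.1
          s_onE := fun a => congrArg (fun z => z.1.1) (f.map.s_onE a)
          t_onE := fun a => congrArg (fun z => z.1.1) (f.map.t_onE a) }
       str_onV := f.str_onV
       str_onE := f.str_onE },
     { map :=
        { onV := fun i => (f.map.onV i).1.2
          onE := fun a => (f.map.onE a).1.2
          s_onE := fun a => congrArg (fun z => z.1.2) (f.map.s_onE a)
          t_onE := fun a => congrArg (fun z => z.1.2) (f.map.t_onE a) }
       str_onV := fun i => (f.map.onV i).2.symm.trans (f.str_onV i)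
       str_onE := fun a => (f.map.onE a).2.symm.trans (f.str_onE a) })
  invFun (g : QuiverOver.Hom Z X × QuiverOver.Hom Z Y) :=
    { map :=
        { onV := fun i => ⟨(g.1.map.onV i, g.2.map.onV i),
            (g.1.str_onV i).trans (g.2.str_onV i).symm⟩
          onE := fun a => ⟨(g.1.map.onE a, g.2.map.onE a),
            (g.1.str_onE a).trans (g.2.str_onE a).symm⟩
          s_onE := fun a => Subtype.ext (Prod.ext (g.1.map.s_onE a) (g.2.map.s_onE a))
          t_onE := fun a => Subtype.ext (Prod.ext (g.1.map.t_onE a) (g.2.map.t_onE a)) }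
      str_onV := g.1.str_onV
      str_onE := g.1.str_onE }
  left_inv _ := rfl
  right_inv _ := rfl

/-- The postcomposition with the inclusions of the components of a disjoint union. -/
def compInclusion (Z : QuiverOver Q) (w : Fin n → QuiverOver Q) (f : Σ i, Z ⟶ w i) :
    Z ⟶ disjointUnion w :=
  f.2 ≫ inclusion w f.1

theorem injective_compInclusion (hZ : Nonempty Z.quiver.V) :
    Function.Injective (compInclusion Z w) := by
  obtain ⟨j₀⟩ := hZ
  rintro ⟨i, f⟩ ⟨i', f'⟩ h
  have hV := congrFun (congrArg (fun h : QuiverOver.Hom Z (disjointUnion w) => h.map.onV) h)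
  have hE := congrFun (congrArg (fun h : QuiverOver.Hom Z (disjointUnion w) => h.map.onE) h)
  obtain rfl : i = i' := congrArg Sigma.fst (hV j₀)
  exact congrArg (Sigma.mk i) (QuiverOver.Hom.ext (FinQuiver.Hom.ext
    (funext fun j => injective_onV_inclusion w i (hV j))
    (funext fun a => injective_onE_inclusion w i (hE a))))

theorem fst_onV_eq_of_isConnected (hZ : Z.quiver.IsConnected)
    (f : QuiverOver.Hom Z (disjointUnion w)) (j j' : Z.quiver.V) :
    (f.map.onV j).1 = (f.map.onV j').1 := by
  induction hZ.2 j j' with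
  | rel _ _ h =>
    obtain ⟨a, rfl, rfl⟩ := h
    have fst_s : (f.map.onE a).1 = (f.map.onV (Z.quiver.s a)).1 :=
      congrArg Sigma.fst (f.map.s_onE a)
    have fst_t : (f.map.onE a).1 = (f.map.onV (Z.quiver.t a)).1 :=
      congrArg Sigma.fst (f.map.t_onE a)
    exact fst_s.symm.trans fst_t
  | refl _ => rfl
  | symm _ _ _ ih => exact ih.symm
  | trans _ _ _ _ _ ih ih' => exact ih.trans ih'

theorem exists_comp_inclusion_eq (f : QuiverOver.Hom Z (disjointUnion w)) {i : Fin n}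
    (hf : ∀ j, (f.map.onV j).1 = i) : ∃ g : Z ⟶ w i, g ≫ inclusion w i = f := by
  have hV (j : Z.quiver.V) : ∃ y : (w i).quiver.V, f.map.onV j = ⟨i, y⟩ := by
    obtain rfl := hf j
    exact ⟨_, rfl⟩
  have hE (a : Z.quiver.E) : ∃ y : (w i).quiver.E, f.map.onE a = ⟨i, y⟩ := by
    obtain rfl : (f.map.onE a).1 = i :=
      (congrArg Sigma.fst (f.map.s_onE a)).trans (hf (Z.quiver.s a))
    exact ⟨_, rfl⟩
  choose gV hgV using hV
  choose gE hgE using hE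
  let g : QuiverOver.Hom Z (w i) :=
    { map :=
        { onV := gV
          onE := gE
          s_onE := fun a => injective_onV_inclusion w i <|
            (congrArg (disjointUnion w).quiver.s (hgE a).symm).trans
              ((f.map.s_onE a).trans (hgV _))
          t_onE := fun a => injective_onV_inclusion w i <|
            (congrArg (disjointUnion w).quiver.t (hgE a).symm).trans
              ((f.map.t_onE a).trans (hgV _)) }
      str_onV := fun j => (congrArg (disjointUnion w).str.onV (hgV j).symm).trans (f.str_onV j)
      str_onE := fun a => (congrArg (disjointUnion w).str.onE (hgE a).symm).trans (f.str_onE a) }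
  exact ⟨g, QuiverOver.Hom.ext (FinQuiver.Hom.ext (funext fun j => (hgV j).symm)
    (funext fun a => (hgE a).symm))⟩

theorem bijective_compInclusion (hZ : Z.quiver.IsConnected) :
    Function.Bijective (compInclusion Z w) := by
  refine ⟨injective_compInclusion hZ.1, fun f => ?_⟩
  obtain ⟨j₀⟩ := hZ.1
  obtain ⟨g, hg⟩ := exists_comp_inclusion_eq f fun j => fst_onV_eq_of_isConnected hZ f j j₀
  exact ⟨⟨_, g⟩, hg⟩

theorem card_hom_fiberProduct (hZ : Z.quiver.IsConnected)
    (e : X.fiberProduct Y ≅ disjointUnion w) :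
    Nat.card (Z ⟶ X) * Nat.card (Z ⟶ Y) = ∑ i, Nat.card (Z ⟶ w i) := calc
  _ = Nat.card (Z ⟶ X.fiberProduct Y) := by
    rw [← Nat.card_prod, Nat.card_congr (homFiberProductEquiv Z X Y)]
  _ = Nat.card (Z ⟶ disjointUnion w) := Nat.card_congr ((Iso.refl Z).homCongr e)
  _ = Nat.card (Σ i, Z ⟶ w i) :=
    (Nat.card_congr (.ofBijective _ (bijective_compInclusion hZ))).symm
  _ = ∑ i, Nat.card (Z ⟶ w i) := Nat.card_sigma

end Counting

end QuiverOver

namespace MobiusRing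

theorem closure_range_of {C : Type*} :
    AddSubgroup.closure (Set.range (of : C → MobiusRing C)) = ⊤ :=
  (AddSubgroup.eq_top_iff' _).2 fun a => by
    refine Finsupp.induction_linear (motive := (· ∈ AddSubgroup.closure (Set.range of))) a
      (zero_mem _) (fun _ _ => add_mem) fun x n => ?_
    have single_eq_zsmul_of : Finsupp.single x n = n • (Finsupp.single x 1 : C →₀ ℤ) := by
      rw [Finsupp.smul_single, zsmul_one, Int.cast_id]
    rw [single_eq_zsmul_of]
    exact zsmul_mem (AddSubgroup.subset_closure (Set.mem_range_self x)) n

theorem map_mul_of_map_of_mul_of {C : Type*} [Category C] [IsLowerFinite C]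
    [IsAcyclicCategory C] {R : Type*} [NonUnitalNonAssocRing R] (f : MobiusRing C →+ R)
    (hf : ∀ x y, f (of x * of y) = f (of x) * f (of y)) (a b : MobiusRing C) :
    f (a * b) = f a * f b := by
  have comp_mul : (AddMonoidHom.mul).compr₂ f = ((AddMonoidHom.mul).comp f).compl₂ f :=
    hom_ext fun x => hom_ext fun y => hf x y
  exact DFunLike.congr_fun (DFunLike.congr_fun comp_mul a) b

end MobiusRing

section Linearization

variable {K : Type u} [Field K] {Q : FinQuiver.{u}} {C : ObjectProperty (QuiverOver Q)}

theorem homCount_fullSubcategory (X Y : C.FullSubcategory) :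
    homCount X Y = Nat.card (X.obj ⟶ Y.obj) :=
  Nat.card_congr InducedCategory.homEquiv

theorem linearizationMap_of (X : C.FullSubcategory) :
    linearizationMap K C (MobiusRing.of X) = (X.obj.linearization K).toRepRing :=
  MobiusRing.lift_of _ X

theorem linearizationMap_injective (hind : ∀ X, C X → (X.linearization K).IsIndecomposable)
    (hniso : ∀ X Y, C X → C Y →
      (X.linearization K).IsIsomorphic (Y.linearization K) → X = Y) :
    Function.Injective (linearizationMap K C) :=
  QuiverRep.linearIndependent_toRepRing (fun X : C.FullSubcategory => X.obj.linearization K)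
    (fun X => hind X.obj X.property) fun X Y h => ObjectProperty.FullSubcategory.ext
      (hniso X.obj Y.obj X.property Y.property h)

variable [IsAcyclicCategory C.FullSubcategory] [IsLowerFinite C.FullSubcategory]

theorem MobiusRing.of_mul_of_eq_sum (hconn : ∀ X, C X → X.quiver.IsConnected)
    (X Y : C.FullSubcategory) {n : ℕ} {w : Fin n → C.FullSubcategory}
    (e : X.obj.fiberProduct Y.obj ≅ QuiverOver.disjointUnion fun i => (w i).obj) :
    MobiusRing.of X * MobiusRing.of Y = ∑ i, MobiusRing.of (w i) := by
  refine MobiusRing.zeta_injective (Finsupp.ext fun Z => ?_)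
  simp only [MobiusRing.zeta_mul, Finsupp.mul_apply, map_sum, Finsupp.finsetSum_apply,
    MobiusRing.zeta_of_apply, homCount_fullSubcategory]
  exact_mod_cast QuiverOver.card_hom_fiberProduct (hconn Z.obj Z.property) e

theorem linearizationMap_mul (hconn : ∀ X, C X → X.quiver.IsConnected)
    (hprod : ClosedUnderFiberProducts C) (a b : MobiusRing C.FullSubcategory) :
    linearizationMap K C (a * b) = linearizationMap K C a * linearizationMap K C b := by
  refine MobiusRing.map_mul_of_map_of_mul_of _ (fun X Y => ?_) a b
  obtain ⟨n, w, hw, ⟨e⟩⟩ := hprod X.obj Y.obj X.property Y.property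
  calc
    _ = ∑ i, ((w i).linearization K).toRepRing := by
      simp only [MobiusRing.of_mul_of_eq_sum hconn X Y (w := fun i => ⟨w i, hw i⟩) e, map_sum,
        linearizationMap_of]
    _ = ((QuiverOver.disjointUnion w).linearization K).toRepRing :=
      (QuiverOver.toRepRing_linearization_disjointUnion w).symm
    _ = ((X.obj.fiberProduct Y.obj).linearization K).toRepRing :=
      (QuiverOver.isIsomorphic_linearization_of_iso e).toRepRing_eq
    _ = _ := by
      rw [QuiverOver.toRepRing_linearization_fiberProduct, linearizationMap_of,
        linearizationMap_of]

variable (K C) in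
/-- The linearization map `M(C) → R(Q)` as a ring homomorphism. -/
noncomputable def linearizationRingHom (hconn : ∀ X, C X → X.quiver.IsConnected)
    (hprod : ClosedUnderFiberProducts C) : MobiusRing C.FullSubcategory →ₙ+* RepRing K Q :=
  { linearizationMap K C with
    map_mul' := linearizationMap_mul hconn hprod }

theorem range_linearizationRingHom (hconn : ∀ X, C X → X.quiver.IsConnected)
    (hprod : ClosedUnderFiberProducts C) :
    (linearizationRingHom K C hconn hprod).range =
      NonUnitalSubring.closure {r | ∃ X, C X ∧ r = (X.linearization K).toRepRing} := by
  refine le_antisymm ?_ (NonUnitalSubring.closure_le.2 ?_)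
  · rintro _ ⟨a, rfl⟩
    have closure_le : AddSubgroup.closure (Set.range MobiusRing.of) ≤
        (NonUnitalSubring.closure
          {r | ∃ X, C X ∧ r = (X.linearization K).toRepRing}).toAddSubgroup.comap
            (linearizationMap K C) := by
      rw [AddSubgroup.closure_le]
      rintro _ ⟨X, rfl⟩
      exact NonUnitalSubring.subset_closure ⟨X.obj, X.property, linearizationMap_of X⟩
    exact closure_le (MobiusRing.closure_range_of ▸ AddSubgroup.mem_top a)
  · rintro _ ⟨X, hX, rfl⟩
    exact ⟨MobiusRing.of ⟨X, hX⟩, linearizationMap_of (C := C) ⟨X, hX⟩⟩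

end Linearization

theorem mainTheorem2 {K : Type u} [Field K] {Q : FinQuiver.{u}}
    (C : ObjectProperty (QuiverOver Q))
    [IsAcyclicCategory C.FullSubcategory] [IsLowerFinite C.FullSubcategory]
    (hconn : ∀ X, C X → X.quiver.IsConnected)
    (hwrap : ∀ X, C X → X.str.IsWrapping)
    (hprod : ClosedUnderFiberProducts C)
    (hind : ∀ X, C X → (X.linearization K).IsIndecomposable)
    (hniso : ∀ X Y, C X → C Y →
      (X.linearization K).IsIsomorphic (Y.linearization K) → X = Y) :
    (∃ φ : MobiusRing C.FullSubcategory →ₙ+* RepRing K Q,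
      (∀ a, φ a = linearizationMap K C a) ∧ Function.Injective φ) ∧
    (∃ e : MobiusRing C.FullSubcategory ≃+*
        NonUnitalSubring.closure
          {r : RepRing K Q | ∃ X, C X ∧ r = (X.linearization K).toRepRing},
      ∀ a, (e a : RepRing K Q) = linearizationMap K C a) := by
  have hinj := linearizationMap_injective (K := K) hind hniso
  refine ⟨⟨linearizationRingHom K C hconn hprod, fun a => rfl, hinj⟩, ?_⟩
  rw [← range_linearizationRingHom hconn hprod]
  exact ⟨RingEquiv.ofBijective (linearizationRingHom K C hconn hprod).rangeRestrict
    ⟨fun a b h => hinj (congrArg Subtype.val h), NonUnitalRingHom.rangeRestrict_surjective _⟩,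
    fun a => rfl⟩
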